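/- Let $f\in\mathbb{Q}[z]$ be a polynomial of odd degree $d\ge 3$ that is unicritical, i.e. its derivative $f'$ has exactly one root in $\overline{\mathbb{Q}}$. For a field $F\supseteq\mathbb{Q}$ and $a\in F$, let $T_a=\bigsqcup_{n\ge 0}f^{-n}(a)$ be the tree of iterated preimages of $a$ in a separable closure $F^{\mathrm{sep}}$: the vertices of level $n$ are the $x\in F^{\mathrm{sep}}$ with $f^n(x)=a$ (where $f^n$ is the $n$-th iterate), and the parent of a vertex $x$ of level $n+1$ is $f(x)$. Let $G_\infty(F,f,a)\le \mathrm{Aut}\,T_a$ be the image of the natural action of $\mathrm{Gal}(F^{\mathrm{sep}}/F)$ on $T_a$. Write $G_\infty(\mathbb{Q},f,t)$ for this group when $F=\mathbb{Q}(t)$ and $a=t$ is transcendental over $\mathbb{Q}$, and $G_\infty(\mathbb{Q},f,\alpha)$ when $F=\mathbb{Q}$ and $a=\alpha\in\mathbb{Q}$. For a subgroup $G$ of $\mathrm{Aut}\,T_a$, let $\pi_n(G)$ be the permutation group that $G$ induces on level $n$, and let $$\mathrm{FPP}(G)=\lim_{n\to\infty}\frac{\#\{g\in\pi_n(G) : g\text{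 fixes some vertex of level }n\}}{|\pi_n(G)|}$$ be its fixed-point proportion. Then the limit defining $\mathrm{FPP}(G_\infty(\mathbb{Q},f,t))$ exists and $$\mathrm{FPP}(G_\infty(\mathbb{Q},f,t))\ \ge\ \prod_{p\mid d}\frac{p-2}{p-1}\ >\ 0,$$ where $p$ runs over the primes dividing $d$. Furthermore, for every $\alpha\in\mathbb{Q}$ that is not strictly post-critical, i.e. $\alpha\ne f^n(c)$ for all $n\ge 1$, where $c$ is the critical point of $f$, the limit defining $\mathrm{FPP}(G_\infty(\mathbb{Q},f,\alpha))$ exists and $$\mathrm{FPP}(G_\infty(\mathbb{Q},f,\alpha))\ \ge\ \prod_{p\mid d}\frac{p-2}{p-1}\ >\ 0.$$ -/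

import Mathlib

open Polynomial Filter Topology

/-- A tree graded by levels: the vertices at each level, and the parent of every vertex at
level `n + 1`. (It is rooted when level `0` is a single vertex.) -/
structure LevelTree where
  /-- the vertices at level `n` -/
  V : ℕ → Type*
  /-- the parent of a vertex at level `n + 1` -/
  parent : ∀ n, V (n + 1) → V n

namespace LevelTree

/-- The group of automorphisms of a tree: families of permutations of the levels that are
compatible with the parent maps. -/
def Aut (T : LevelTree) : Subgroup (∀ n, Equiv.Perm (T.V n)) where
  carrier := {g | ∀ n v, T.parent n (g (n + 1) v) = g n (T.parent n v)}
  one_mem' := fun _ _ => rfl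
  mul_mem' := by
    intro g h hg hh n v
    simp only [Pi.mul_apply, Equiv.Perm.mul_apply]
    rw [hg, hh]
  inv_mem' := by
    intro g hg n v
    simp only [Pi.inv_apply]
    rw [Equiv.Perm.eq_inv_iff_eq, ← hg]
    simp

/-- The action of `Aut T` on the `n`-th level. -/
def levelHom (T : LevelTree) (n : ℕ) : T.Aut →* Equiv.Perm (T.V n) :=
  (Pi.evalMonoidHom (fun n => Equiv.Perm (T.V n)) n).comp T.Aut.subtype

/-- `π_n(G)`: the permutation group that `G ≤ Aut T` induces on the `n`-th level. -/
def levelGroup {T : LevelTree} (G : Subgroup T.Aut) (n : ℕ) : Subgroup (Equiv.Perm (T.V n)) :=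
  G.map (T.levelHom n)

/-- The proportion of elements of `π_n(G)` that fix some vertex at level `n`. -/
noncomputable def fixedProportion {T : LevelTree} (G : Subgroup T.Aut) (n : ℕ) : ℝ :=
  (Nat.card {g : levelGroup G n // ∃ v : T.V n, (g : Equiv.Perm (T.V n)) v = v} : ℝ) /
    (Nat.card (levelGroup G n) : ℝ)

/-- The fixed-point proportion `FPP(G)`, the limit of the level proportions. -/
noncomputable def FPP {T : LevelTree} (G : Subgroup T.Aut) : ℝ :=
  limUnder atTop (fixedProportion G)

end LevelTree

section Arboreal

/-- The tree `⨆ₙ f⁻ⁿ(a)` of iterated preimages of `a ∈ F` in a separable closure of `F`: the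
vertices at level `n` are the solutions `x` of `fⁿ(x) = a`, and the parent of `x` is `f(x)`. -/
noncomputable def preimageTree {F : Type*} [Field F] (f : F[X]) (a : F) : LevelTree where
  V n := {x : SeparableClosure F //
    (fun y : SeparableClosure F => aeval y f)^[n] x = algebraMap F (SeparableClosure F) a}
  parent _ x := ⟨aeval x.1 f, x.2⟩

theorem galois_iterate {F : Type*} [Field F] (f : F[X])
    (σ : SeparableClosure F ≃ₐ[F] SeparableClosure F) (n : ℕ) (x : SeparableClosure F) :
    (fun y : SeparableClosure F => aeval y f)^[n] (σ x) =
      σ ((fun y : SeparableClosure F => aeval y f)^[n] x) := by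
  induction n generalizing x with
  | zero => rfl
  | succ n ih =>
    rw [Function.iterate_succ_apply, Function.iterate_succ_apply, ← ih]
    congr 1
    exact aeval_algHom_apply σ.toAlgHom x f

/-- The arboreal Galois representation: the action of the absolute Galois group of `F` on the
tree of iterated preimages of `a`. -/
noncomputable def arborealRep {F : Type*} [Field F] (f : F[X]) (a : F) :
    (SeparableClosure F ≃ₐ[F] SeparableClosure F) →* (preimageTree f a).Aut where
  toFun σ := ⟨fun n => σ.toEquiv.subtypeEquiv fun x => by
      change _ ↔ (fun y : SeparableClosure F => aeval y f)^[n] (σ x) = _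
      rw [galois_iterate, ← σ.commutes a, σ.injective.eq_iff, σ.commutes],
    fun _ x => Subtype.ext (aeval_algHom_apply σ.toAlgHom x.1 f)⟩
  map_one' := rfl
  map_mul' _ _ := rfl

/-- The image of the arboreal Galois representation of `f` over `F` with base point `a`,
a subgroup of the automorphism group of the tree of iterated preimages of `a`. For `F = K`,
`a = α` this is `G_∞(K, f, α)`. -/
noncomputable def arborealGroup {F : Type*} [Field F] (f : F[X]) (a : F) :
    Subgroup (preimageTree f a).Aut :=
  (arborealRep f a).range

/-- The arithmetic iterated Galois group `G_∞(K, f, t)` of `f ∈ K[z]`: the base field is the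
rational function field `K(t)` and the base point is its variable `t`. -/
noncomputable def arithmeticGaloisGroup {K : Type*} [Field K] (f : K[X]) :
    Subgroup (preimageTree (f.map (algebraMap K (RatFunc K))) (RatFunc.X : RatFunc K)).Aut :=
  arborealGroup (f.map (algebraMap K (RatFunc K))) (RatFunc.X : RatFunc K)

end Arboreal

/-- The (finite) critical points of `f`, in an algebraic closure of `K`. -/
def criticalPoints {K : Type*} [Field K] (f : K[X]) : Set (AlgebraicClosure K) :=
  {c | aeval c (derivative f) = 0}

/-- `f` is unicritical if it has exactly one critical point. -/
def IsUnicritical {K : Type*} [Field K] (f : K[X]) : Prop :=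
  ∃! c : AlgebraicClosure K, c ∈ criticalPoints f

/-- `α` is strictly post-critical if `α = fⁿ(c)` for some critical point `c` and some `n ≥ 1`. -/
def IsStrictlyPostcritical {K : Type*} [Field K] (f : K[X]) (α : K) : Prop :=
  ∃ n : ℕ, 1 ≤ n ∧ ∃ c ∈ criticalPoints f,
    (fun y : AlgebraicClosure K => aeval y f)^[n] c = algebraMap K (AlgebraicClosure K) α

/-!
Write `f = a (z - c) ^ d + b`, so that `b = f c` is the critical value, and let `σ` act on the
`d`-th roots of unity through `u ∈ (ℤ/d)ˣ`. The fibre of `f` over a point fixed by `σ` consists of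
the points `ζ ^ j z + c`, on which `σ` acts as `j ↦ u j + k` for some `k`. If `u - 1` is a unit
modulo `d`, this affine map has a fixed point, and so, climbing the tree, `σ` fixes a vertex at
every level.

When the base point is not the critical value, `σ` is trivial on the roots of unity as soon as it
acts trivially on level one, so `u` is a function of the permutation that `σ` induces on any level
`n ≥ 1`. Every unit modulo `d` occurs, because the `d`-th cyclotomic polynomial is irreducible over
the base field. Hence the proportion of permutations with a fixed vertex is at least the proportion
of `u ∈ (ℤ/d)ˣ` with `u ≢ 1` modulo every prime `p ∣ d`, which is `∏ (p - 2) / (p - 1)` by the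
Chinese remainder theorem.

A fixed vertex has a fixed parent, so these proportions decrease with the level and converge.
-/

section Proportion

/-- The proportion `#S / #α` of the elements of a finite type `α` that lie in `S`. The
fixed-point proportion at each level of a tree is of this form. -/
noncomputable def proportion {α : Type*} (S : Set α) : ℝ :=
  Nat.card S / Nat.card α

theorem proportion_nonneg {α : Type*} (S : Set α) : 0 ≤ proportion S := by
  unfold proportion
  positivity

theorem proportion_mono {α : Type*} [Finite α] {S T : Set α} (h : S ⊆ T) :
    proportion S ≤ proportion T := by
  unfold proportion
  gcongr
  exact Nat.card_mono T.toFinite h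

theorem proportion_compl_singleton {α : Type*} [Finite α] (a : α) :
    proportion ({a}ᶜ : Set α) = (Nat.card α - 1) / Nat.card α := by
  have hcard : Nat.card ({a} : Set α) + Nat.card ({a}ᶜ : Set α) = Nat.card α :=
    Set.ncard_add_ncard_compl {a}
  rw [Nat.card_unique] at hcard
  rw [proportion, ← hcard]
  push_cast
  ring

theorem proportion_univ_pi {ι : Type*} [Fintype ι] {α : ι → Type*} (S : ∀ i, Set (α i)) :
    proportion (Set.univ.pi S) = ∏ i, proportion (S i) := by
  simp only [proportion, Nat.card_congr (Equiv.Set.univPi S), Nat.card_pi, Nat.cast_prod,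
    Finset.prod_div_distrib]

variable {A G H : Type*} [Group A] [Group G] [Group H]

theorem card_preimage_of_surjective (φ : G →* H) (hφ : Function.Surjective φ) (T : Set H) :
    Nat.card (φ ⁻¹' T) = Nat.card φ.ker * Nat.card T := by
  let e := QuotientGroup.quotientKerEquivOfSurjective φ hφ
  have hpre : φ ⁻¹' T = QuotientGroup.mk ⁻¹' (e ⁻¹' T) := rfl
  rw [hpre, Nat.card_congr (QuotientGroup.preimageMkEquivSubgroupProdSet _ _), Nat.card_prod,
    Nat.card_preimage_of_injective e.injective fun h _ => e.surjective h]

theorem proportion_preimage [Finite G] (φ : G →* H) (hφ : Function.Surjective φ) (T : Set H) :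
    proportion (φ ⁻¹' T) = proportion T := by
  have hG : Nat.card G = Nat.card φ.ker * Nat.card H := by
    simpa using card_preimage_of_surjective φ hφ Set.univ
  have hker : (Nat.card φ.ker : ℝ) ≠ 0 := Nat.cast_ne_zero.2 Nat.card_pos.ne'
  rw [proportion, proportion, hG, card_preimage_of_surjective φ hφ]
  push_cast
  exact mul_div_mul_left _ _ hker

theorem exists_hom_apply_eq_of_ker_le {ρ : A →* G} {τ : A →* H} (hρ : Function.Surjective ρ)
    (hker : ρ.ker ≤ τ.ker) : ∃ φ : G →* H, ∀ a, φ (ρ a) = τ a :=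
  ⟨ρ.liftOfSurjective hρ ⟨τ, hker⟩, ρ.liftOfRightInverse_comp_apply _ _ ⟨τ, hker⟩⟩

theorem proportion_image_preimage [Finite G] {ρ : A →* G} {τ : A →* H}
    (hρ : Function.Surjective ρ) (hτ : Function.Surjective τ) (hker : ρ.ker ≤ τ.ker)
    (T : Set H) : proportion (ρ '' (τ ⁻¹' T)) = proportion T := by
  obtain ⟨φ, hφ⟩ := exists_hom_apply_eq_of_ker_le hρ hker
  have hφ_surj : Function.Surjective φ := fun h =>
    (hτ h).imp' ρ fun a ha => (hφ a).trans ha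
  have himage : ρ '' (τ ⁻¹' T) = φ ⁻¹' T := by
    rw [← Set.image_preimage_eq (φ ⁻¹' T) hρ]
    simp only [Set.preimage, Set.mem_ofPred_eq, hφ]
  rw [himage, proportion_preimage φ hφ_surj]

end Proportion

namespace LevelTree

variable {T : LevelTree}

theorem levelHom_parent_eq {g : T.Aut} {n : ℕ} {w : T.V (n + 1)}
    (hw : T.levelHom (n + 1) g w = w) : T.levelHom n g (T.parent n w) = T.parent n w :=
  (g.2 n w).symm.trans (congrArg (T.parent n) hw)

theorem ker_levelHom_antitone (hsurj : ∀ n, Function.Surjective (T.parent n)) :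
    Antitone fun n => (T.levelHom n).ker :=
  antitone_nat_of_succ_le fun n g hg => Equiv.ext fun v => by
    obtain ⟨w, rfl⟩ := hsurj n v
    exact levelHom_parent_eq (Equiv.congr_fun hg w)

theorem proportion_le_fixedProportion {A H : Type*} [Group A] [Group H] {ρ : A →* T.Aut}
    {τ : A →* H} (hτ : Function.Surjective τ) {n : ℕ} [Finite (T.V n)]
    (hker : ∀ a, T.levelHom n (ρ a) = 1 → τ a = 1) {U : Set H}
    (hfix : ∀ a, τ a ∈ U → ∃ v, T.levelHom n (ρ a) v = v) :
    proportion U ≤ fixedProportion ρ.range n := by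
  let ρₙ : A →* levelGroup ρ.range n :=
    ((T.levelHom n).subgroupMap ρ.range).comp ρ.rangeRestrict
  have hρₙ : Function.Surjective ρₙ :=
    (MonoidHom.subgroupMap_surjective _ _).comp ρ.rangeRestrict_surjective
  have hker' : ρₙ.ker ≤ τ.ker := fun a ha => hker a (congrArg Subtype.val ha)
  rw [← proportion_image_preimage hρₙ hτ hker' U]
  exact proportion_mono (Set.image_subset_iff.2 hfix)

theorem fixedProportion_antitone (G : Subgroup T.Aut) [∀ n, Finite (T.V n)]
    (hsurj : ∀ n, Function.Surjective (T.parent n)) : Antitone (fixedProportion G) := by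
  refine antitone_nat_of_succ_le fun n => ?_
  let ρ (m : ℕ) : G →* levelGroup G m := (T.levelHom m).subgroupMap G
  have hρ (m : ℕ) : Function.Surjective (ρ m) := MonoidHom.subgroupMap_surjective _ _
  have hker : (ρ (n + 1)).ker ≤ (ρ n).ker := fun g hg =>
    Subtype.ext (ker_levelHom_antitone hsurj n.le_succ (congrArg Subtype.val hg))
  change _ ≤ proportion {g : levelGroup G n | ∃ v, (g : Equiv.Perm (T.V n)) v = v}
  rw [← proportion_image_preimage (hρ (n + 1)) (hρ n) hker]
  refine proportion_mono ?_
  rintro x ⟨w, hw⟩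
  obtain ⟨g, rfl⟩ := hρ (n + 1) x
  exact ⟨g, ⟨T.parent n w, levelHom_parent_eq hw⟩, rfl⟩

theorem tendsto_fixedProportion (G : Subgroup T.Aut) [∀ n, Finite (T.V n)]
    (hsurj : ∀ n, Function.Surjective (T.parent n)) :
    Tendsto (fixedProportion G) atTop (𝓝 (FPP G)) := by
  have hbdd : BddBelow (Set.range (fixedProportion G)) :=
    ⟨0, Set.forall_mem_range.2 fun _ => proportion_nonneg _⟩
  exact tendsto_nhds_limUnder ⟨_, tendsto_atTop_ciInf (fixedProportion_antitone G hsurj) hbdd⟩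

theorem le_FPP {G : Subgroup T.Aut} [∀ n, Finite (T.V n)]
    (hsurj : ∀ n, Function.Surjective (T.parent n)) {r : ℝ}
    (hr : ∀ n, r ≤ fixedProportion G (n + 1)) : r ≤ FPP G :=
  ge_of_tendsto' ((tendsto_add_atTop_iff_nat 1).2 (tendsto_fixedProportion G hsurj)) hr

end LevelTree

section Units

theorem isUnit_zmod_iff_castHom_ne_zero {d : ℕ} [NeZero d] (x : ZMod d) :
    IsUnit x ↔ ∀ p : d.primeFactors,
      ZMod.castHom (Nat.dvd_of_mem_primeFactors p.2) (ZMod p) x ≠ 0 := by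
  obtain ⟨m, rfl⟩ := ZMod.natCast_zmod_surjective x
  simp only [ZMod.isUnit_iff_coprime, map_natCast, ne_eq, ZMod.natCast_eq_zero_iff]
  rw [← not_iff_not, Nat.Prime.not_coprime_iff_dvd]
  simp [NeZero.ne d, and_comm, and_assoc]

/-- The reduction of the units modulo `d` to the units modulo all prime divisors of `d`, through
which being congruent to `1` modulo no prime divisor becomes a condition on each factor. -/
def unitsToPrimes (d : ℕ) : (ZMod d)ˣ →* ∀ p : d.primeFactors, (ZMod p)ˣ :=
  MonoidHom.pi fun p => ZMod.unitsMap (Nat.dvd_of_mem_primeFactors p.2)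

theorem exists_natCast_eq_of_primeFactors (d : ℕ) (x : ∀ p : d.primeFactors, ZMod p) :
    ∃ k : ℕ, ∀ p : d.primeFactors, (k : ZMod p) = x p := by
  have hprime (p : d.primeFactors) : (p : ℕ).Prime := Nat.prime_of_mem_primeFactors p.2
  have (p : d.primeFactors) : NeZero (p : ℕ) := ⟨(hprime p).ne_zero⟩
  obtain ⟨k, hk⟩ := Nat.chineseRemainderOfFinset (fun p : d.primeFactors => (x p).val)
    (fun p => (p : ℕ)) (t := Finset.univ) (fun p _ => (hprime p).ne_zero)
    fun p _ q _ hpq => (Nat.coprime_primes (hprime p) (hprime q)).2 (Subtype.coe_ne_coe.2 hpq)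
  refine ⟨k, fun p => ?_⟩
  rw [(ZMod.natCast_eq_natCast_iff _ _ _).2 (hk p (Finset.mem_univ p)), ZMod.natCast_zmod_val]

theorem unitsToPrimes_surjective (d : ℕ) [NeZero d] : Function.Surjective (unitsToPrimes d) := by
  intro u
  obtain ⟨k, hk⟩ := exists_natCast_eq_of_primeFactors d fun p => (u p : ZMod p)
  have (p : d.primeFactors) : Fact (p : ℕ).Prime := ⟨Nat.prime_of_mem_primeFactors p.2⟩
  have hunit : IsUnit (k : ZMod d) := (isUnit_zmod_iff_castHom_ne_zero _).2 fun p => by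
    rw [map_natCast, hk]
    exact (u p).ne_zero
  refine ⟨hunit.unit, funext fun p => Units.ext ?_⟩
  exact (map_natCast (ZMod.castHom (Nat.dvd_of_mem_primeFactors p.2) (ZMod p)) k).trans (hk p)

theorem isUnit_sub_one_iff_unitsToPrimes {d : ℕ} [NeZero d] (u : (ZMod d)ˣ) :
    IsUnit ((u : ZMod d) - 1) ↔ ∀ p, unitsToPrimes d u p ≠ 1 := by
  simp only [isUnit_zmod_iff_castHom_ne_zero, map_sub, map_one, sub_ne_zero, ne_eq, Units.ext_iff]
  rfl

theorem proportion_units_zmod_ne_one (p : ℕ) [Fact p.Prime] :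
    proportion ({1}ᶜ : Set (ZMod p)ˣ) = ((p : ℝ) - 2) / ((p : ℝ) - 1) := by
  rw [proportion_compl_singleton, Nat.card_eq_fintype_card, ZMod.card_units,
    Nat.cast_sub (Fact.out : p.Prime).one_le]
  ring

theorem proportion_isUnit_sub_one (d : ℕ) [NeZero d] :
    proportion {u : (ZMod d)ˣ | IsUnit ((u : ZMod d) - 1)} =
      ∏ p ∈ d.primeFactors, ((p : ℝ) - 2) / ((p : ℝ) - 1) := by
  have (p : d.primeFactors) : Fact (p : ℕ).Prime := ⟨Nat.prime_of_mem_primeFactors p.2⟩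
  have hpre : {u : (ZMod d)ˣ | IsUnit ((u : ZMod d) - 1)} =
      unitsToPrimes d ⁻¹' Set.univ.pi fun _ => {1}ᶜ := by
    ext u
    simp [isUnit_sub_one_iff_unitsToPrimes]
  rw [hpre, proportion_preimage _ (unitsToPrimes_surjective d), proportion_univ_pi,
    ← Finset.prod_coe_sort d.primeFactors fun p => ((p : ℝ) - 2) / ((p : ℝ) - 1)]
  exact Finset.prod_congr rfl fun p _ => proportion_units_zmod_ne_one p

theorem prod_sub_two_div_sub_one_pos {d : ℕ} (hodd : Odd d) :
    0 < ∏ p ∈ d.primeFactors, ((p : ℝ) - 2) / ((p : ℝ) - 1) := by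
  refine Finset.prod_pos fun p hp => ?_
  have hdvd : p ∣ d := Nat.dvd_of_mem_primeFactors hp
  have hne : p ≠ 2 := by
    rintro rfl
    exact Nat.not_even_iff_odd.2 hodd (even_iff_two_dvd.2 hdvd)
  have hlt : (2 : ℝ) < p := by
    exact_mod_cast (Nat.prime_of_mem_primeFactors hp).two_le.lt_of_ne' hne
  exact div_pos (by linarith) (by linarith)

end Units

section CyclotomicCharacter

theorem pow_eq_pow_iff_natCast_zmod_eq {M : Type*} [CommMonoid M] {d : ℕ} [NeZero d] {ζ : M}
    (hζ : IsPrimitiveRoot ζ d) {m n : ℕ} : ζ ^ m = ζ ^ n ↔ (m : ZMod d) = n := by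
  rw [ZMod.natCast_eq_natCast_iff, (hζ.isOfFinOrder (NeZero.ne d)).pow_eq_pow_iff_modEq,
    ← hζ.eq_orderOf]

variable {F L : Type*} [Field F] [Field L] [Algebra F L] {d : ℕ} [NeZero d] {ζ : L}

theorem autToPow_eq_natCast (hζ : IsPrimitiveRoot ζ d) {σ : L ≃ₐ[F] L} {m : ℕ}
    (hσ : σ ζ = ζ ^ m) : (hζ.autToPow F σ : ZMod d) = m := by
  rw [← hζ.autToPow_spec F σ, pow_eq_pow_iff_natCast_zmod_eq hζ, ZMod.natCast_zmod_val] at hσ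
  exact hσ

theorem autToPow_eq_one (hζ : IsPrimitiveRoot ζ d) {σ : L ≃ₐ[F] L} (hσ : σ ζ = ζ) :
    hζ.autToPow F σ = 1 :=
  Units.ext <| by simpa using autToPow_eq_natCast hζ (hσ.trans (pow_one ζ).symm)

theorem autToPow_surjective [Normal F L] (hζ : IsPrimitiveRoot ζ d)
    (hirr : Irreducible (cyclotomic d F)) : Function.Surjective (hζ.autToPow F) := by
  intro u
  have : NeZero (d : L) := hζ.neZero'
  have : NeZero (d : F) := NeZero.nat_of_neZero (algebraMap F L)
  have hζu : IsPrimitiveRoot (ζ ^ (u : ZMod d).val) d :=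
    hζ.pow_of_coprime _ (ZMod.val_coe_unit_coprime u)
  have hroot : aeval (ζ ^ (u : ZMod d).val) (minpoly F ζ) = 0 := by
    rw [← hζ.minpoly_eq_cyclotomic_of_irreducible hirr,
      hζu.minpoly_eq_cyclotomic_of_irreducible hirr, minpoly.aeval]
  obtain ⟨σ, hσ⟩ :=
    minpoly.exists_algEquiv_of_root' (Algebra.IsAlgebraic.isAlgebraic ζ) hroot
  exact ⟨σ, Units.ext <| by simpa using autToPow_eq_natCast hζ hσ⟩

theorem exists_apply_pow_mul_eq (hζ : IsPrimitiveRoot ζ d) {σ : L ≃ₐ[F] L}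
    (hσ : IsUnit ((hζ.autToPow F σ : ZMod d) - 1)) {z : L} (hz : σ (z ^ d) = z ^ d) :
    ∃ j : ℕ, σ (ζ ^ j * z) = ζ ^ j * z := by
  rcases eq_or_ne z 0 with rfl | hz₀
  · exact ⟨0, by simp⟩
  obtain ⟨k, hk⟩ : ∃ k : ℕ, ζ ^ k * z = σ z := by
    have hquot : (σ z / z) ^ d = 1 := by
      rw [div_pow, ← map_pow, hz, div_self (pow_ne_zero d hz₀)]
    obtain ⟨k, -, hk⟩ := hζ.eq_pow_of_pow_eq_one hquot
    exact ⟨k, by rw [hk, div_mul_cancel₀ _ hz₀]⟩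
  set χ : ZMod d := ((hζ.autToPow F σ : (ZMod d)ˣ) : ZMod d)
  -- `σ` multiplies the exponent `j` by `χ` and adds `k`, so `j` must solve `χ j + k = j`.
  obtain ⟨v, hv⟩ := hσ
  obtain ⟨j, hj⟩ := ZMod.natCast_zmod_surjective (-(↑v⁻¹ * k : ZMod d))
  have hsolve : χ * j + k = j := by
    have hvj : (χ - 1) * j = -k := by rw [hj, ← hv, mul_neg, v.mul_inv_cancel_left]
    linear_combination hvj
  refine ⟨j, ?_⟩
  rw [map_mul, map_pow, ← hk, ← hζ.autToPow_spec F σ, ← mul_assoc, ← pow_mul, ← pow_add]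
  congr 1
  rw [pow_eq_pow_iff_natCast_zmod_eq hζ]
  push_cast
  rwa [ZMod.natCast_zmod_val]

end CyclotomicCharacter

section RatFunc

variable {K : Type*} [Field K]

theorem irreducible_map_ratFunc {p : K[X]} (hp : p.Monic) (hirr : Irreducible p) :
    Irreducible (p.map (algebraMap K (RatFunc K))) := by
  have hpoly : Irreducible (p.map (C : K →+* K[X])) := by
    refine (hp.map C).irreducible_of_irreducible_map (evalRingHom 0) _ ?_
    rwa [Polynomial.map_map, show (evalRingHom (0 : K)).comp C = RingHom.id K by ext; simp,
      Polynomial.map_id]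
  have hfrac := ((hp.map C).irreducible_iff_irreducible_map_fraction_map (K := RatFunc K)).1 hpoly
  rwa [Polynomial.map_map] at hfrac

theorem ratFunc_X_ne_algebraMap (x : K) : RatFunc.X ≠ algebraMap K (RatFunc K) x := fun h =>
  RatFunc.transcendental_X (h ▸ isAlgebraic_algebraMap x)

end RatFunc

section UnicriticalPoly

/-- The polynomial `a (z - c) ^ d + b`. Over a field of characteristic zero every unicritical
polynomial has this form, with critical point `c` and critical value `b`. -/
noncomputable def unicriticalPoly {F : Type*} [Field F] (a b c : F) (d : ℕ) : F[X] :=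
  C a * (X - C c) ^ d + C b

variable {F : Type*} [Field F] {a b c : F} {d : ℕ}

theorem natDegree_unicriticalPoly (ha : a ≠ 0) : (unicriticalPoly a b c d).natDegree = d := by
  rw [unicriticalPoly, natDegree_add_C, natDegree_C_mul ha, natDegree_pow, natDegree_X_sub_C,
    mul_one]

theorem map_unicriticalPoly {E : Type*} [Field E] (i : F →+* E) :
    (unicriticalPoly a b c d).map i = unicriticalPoly (i a) (i b) (i c) d := by
  simp [unicriticalPoly]

theorem aeval_algebraMap_unicriticalPoly {L : Type*} [Field L] [Algebra F L] (hd : d ≠ 0) :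
    aeval (algebraMap F L c) (unicriticalPoly a b c d) = algebraMap F L b := by
  simp [unicriticalPoly, hd]

theorem aeval_add_unicriticalPoly_eq_iff {L : Type*} [Field L] [Algebra F L] (ha : a ≠ 0)
    {y z : L} : aeval (z + algebraMap F L c) (unicriticalPoly a b c d) = y ↔
      z ^ d = (y - algebraMap F L b) / algebraMap F L a := by
  have ha' : algebraMap F L a ≠ 0 := by simpa using ha
  rw [eq_div_iff ha', eq_sub_iff_add_eq, mul_comm]
  simp [unicriticalPoly]

theorem exists_eq_unicriticalPoly_of_derivative_eq [CharZero F] {f : F[X]} {e : F} {n : ℕ}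
    (hf : derivative f = C e * (X - C c) ^ n) :
    ∃ b, f = unicriticalPoly (e / (n + 1 : ℕ)) b c (n + 1) := by
  set g := C (e / (n + 1 : ℕ)) * (X - C c) ^ (n + 1) with hg
  have hderiv : derivative (f - g) = 0 := by
    rw [derivative_sub, hf, hg, derivative_C_mul, derivative_X_sub_C_pow, ← mul_assoc,
      ← C_mul, div_mul_cancel₀ _ (Nat.cast_ne_zero.2 n.succ_ne_zero),
      Nat.add_sub_cancel, sub_self]
  refine ⟨(f - g).coeff 0, ?_⟩
  rw [unicriticalPoly, ← hg, ← eq_C_of_natDegree_eq_zero (derivative_eq_zero.1 hderiv),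
    add_sub_cancel]

theorem exists_eq_C_mul_X_sub_C_pow [CharZero F] {L : Type*} [Field L] [Algebra F L]
    [IsAlgClosed L] {p : F[X]} (hp : ∃! x : L, aeval x p = 0) :
    ∃ (e c : F) (n : ℕ), e ≠ 0 ∧ n ≠ 0 ∧ p = C e * (X - C c) ^ n := by
  classical
  obtain ⟨x, hx, huniq⟩ := hp
  have hp₀ : p ≠ 0 := by
    rintro rfl
    exact zero_ne_one ((huniq 0 (by simp)).trans (huniq 1 (by simp)).symm)
  have hlead : p.leadingCoeff ≠ 0 := leadingCoeff_ne_zero.2 hp₀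
  have hroots : (p.aroots L).toFinset = {x} := by
    ext y
    rw [Multiset.mem_toFinset, mem_aroots, Finset.mem_singleton]
    exact ⟨fun h => huniq y h.2, fun h => ⟨hp₀, h ▸ hx⟩⟩
  have hsep : (C p.leadingCoeff⁻¹ * p).natSepDegree = 1 := by
    rw [natSepDegree_C_mul _ (inv_ne_zero hlead), natSepDegree_eq_of_isAlgClosed L, hroots,
      Finset.card_singleton]
  have hmonic : (C p.leadingCoeff⁻¹ * p).Monic := by
    rw [mul_comm]
    exact monic_mul_leadingCoeff_inv hp₀
  obtain ⟨n, m, c, hn, h⟩ := (hmonic.natSepDegree_eq_one_iff 1).1 hsep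
  refine ⟨p.leadingCoeff, c, n, hlead, hn, ?_⟩
  rw [one_pow, pow_one] at h
  rw [← h, ← mul_assoc, ← C_mul, mul_inv_cancel₀ hlead, C_1, one_mul]

theorem IsUnicritical.exists_eq_unicriticalPoly [CharZero F] {f : F[X]} (hf : IsUnicritical f) :
    ∃ (a b c : F) (d : ℕ), a ≠ 0 ∧ d ≠ 0 ∧ algebraMap F (AlgebraicClosure F) c ∈ criticalPoints f ∧
      f = unicriticalPoly a b c d := by
  obtain ⟨e, c, n, he, hn, hderiv⟩ := exists_eq_C_mul_X_sub_C_pow hf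
  obtain ⟨b, hb⟩ := exists_eq_unicriticalPoly_of_derivative_eq hderiv
  refine ⟨_, b, c, n + 1, div_ne_zero he (Nat.cast_ne_zero.2 n.succ_ne_zero), n.succ_ne_zero,
    ?_, hb⟩
  simp [criticalPoints, hderiv, hn]

end UnicriticalPoly

section PreimageTree

variable {F : Type*} [Field F] {f : F[X]}

theorem finite_setOf_aeval_eq {E : Type*} [Field E] [Algebra F E] (hf : f.natDegree ≠ 0) (y : E) :
    {x : E | aeval x f = y}.Finite := by
  by_contra hinf
  have hconst : f.map (algebraMap F E) = C y :=
    eq_of_infinite_eval_eq _ _ (by simpa [eval_map_algebraMap] using hinf)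
  exact hf (by rw [← natDegree_map (algebraMap F E), hconst, natDegree_C])

theorem finite_preimageTree (hf : f.natDegree ≠ 0) (x₀ : F) (n : ℕ) :
    Finite ((preimageTree f x₀).V n) := by
  let φ : SeparableClosure F → SeparableClosure F := fun y => aeval y f
  suffices h : (φ^[n] ⁻¹' {algebraMap F (SeparableClosure F) x₀}).Finite from h.to_subtype
  induction n with
  | zero => exact Set.finite_singleton _
  | succ n ih =>
    rw [Function.iterate_succ, Set.preimage_comp]
    exact ih.preimage' fun y _ => finite_setOf_aeval_eq hf y

theorem parent_preimageTree_surjective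
    (hf : Function.Surjective fun x : SeparableClosure F => aeval x f) (x₀ : F) (n : ℕ) :
    Function.Surjective ((preimageTree f x₀).parent n) := by
  rintro ⟨y, hy⟩
  obtain ⟨x, rfl⟩ := hf y
  exact ⟨⟨x, hy⟩, rfl⟩

theorem exists_levelHom_arborealRep_apply_eq {σ : SeparableClosure F ≃ₐ[F] SeparableClosure F}
    (hσ : ∀ y, σ y = y → ∃ x, aeval x f = y ∧ σ x = x) (x₀ : F) (n : ℕ) :
    ∃ v, (preimageTree f x₀).levelHom n (arborealRep f x₀ σ) v = v := by
  induction n with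
  | zero => exact ⟨⟨algebraMap F _ x₀, rfl⟩, Subtype.ext (σ.commutes x₀)⟩
  | succ n ih =>
    obtain ⟨⟨y, hy⟩, hfix⟩ := ih
    obtain ⟨x, rfl, hx⟩ := hσ y (congrArg Subtype.val hfix)
    exact ⟨⟨x, hy⟩, Subtype.ext hx⟩

end PreimageTree

section ArborealUnicritical

variable {F : Type*} [Field F] {a b c : F} {d : ℕ}

theorem aeval_unicriticalPoly_surjective [NeZero (d : F)] (ha : a ≠ 0) :
    Function.Surjective fun x : SeparableClosure F => aeval x (unicriticalPoly a b c d) := by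
  intro y
  have : NeZero (d : SeparableClosure F) := NeZero.nat_of_injective (algebraMap F _).injective
  obtain ⟨z, hz⟩ := IsSepClosed.exists_pow_nat_eq
    ((y - algebraMap F (SeparableClosure F) b) / algebraMap F (SeparableClosure F) a) d
  exact ⟨_, (aeval_add_unicriticalPoly_eq_iff ha).2 hz⟩

theorem finite_preimageTree_unicriticalPoly [NeZero d] (ha : a ≠ 0) (x₀ : F) (n : ℕ) :
    Finite ((preimageTree (unicriticalPoly a b c d) x₀).V n) :=
  finite_preimageTree (by rw [natDegree_unicriticalPoly ha]; exact NeZero.ne d) x₀ n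

theorem tendsto_fixedProportion_unicriticalPoly [NeZero (d : F)] (ha : a ≠ 0) (x₀ : F) :
    Tendsto (LevelTree.fixedProportion (arborealGroup (unicriticalPoly a b c d) x₀)) atTop
      (𝓝 (LevelTree.FPP (arborealGroup (unicriticalPoly a b c d) x₀))) := by
  have : NeZero d := .of_neZero_natCast F
  have := finite_preimageTree_unicriticalPoly (b := b) (c := c) (d := d) ha x₀
  exact LevelTree.tendsto_fixedProportion _
    (parent_preimageTree_surjective (aeval_unicriticalPoly_surjective ha) x₀)

variable [NeZero d] {ζ : SeparableClosure F} {σ : SeparableClosure F ≃ₐ[F] SeparableClosure F}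

theorem exists_fixed_preimage_unicriticalPoly (ha : a ≠ 0) (hζ : IsPrimitiveRoot ζ d)
    (hσ : IsUnit ((hζ.autToPow F σ : ZMod d) - 1)) {y : SeparableClosure F} (hy : σ y = y) :
    ∃ x, aeval x (unicriticalPoly a b c d) = y ∧ σ x = x := by
  have : NeZero (d : SeparableClosure F) := hζ.neZero'
  obtain ⟨z, hz⟩ := IsSepClosed.exists_pow_nat_eq
    ((y - algebraMap F (SeparableClosure F) b) / algebraMap F (SeparableClosure F) a) d
  obtain ⟨j, hj⟩ := exists_apply_pow_mul_eq hζ hσ (z := z) (by simp [hz, hy])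
  refine ⟨ζ ^ j * z + algebraMap F _ c, (aeval_add_unicriticalPoly_eq_iff ha).2 ?_, ?_⟩
  · rw [mul_pow, pow_right_comm, hζ.pow_eq_one, one_pow, one_mul, hz]
  · rw [map_add, hj, σ.commutes]

-- Level one consists of the points `z + c` with `z ^ d = (x₀ - b) / a`, and the ratios of these
-- `z ≠ 0` are the `d`-th roots of unity.
theorem autToPow_eq_one_of_levelHom_one_eq_one (ha : a ≠ 0) (hζ : IsPrimitiveRoot ζ d) {x₀ : F}
    (hx₀ : x₀ ≠ b) (hσ : (preimageTree (unicriticalPoly a b c d) x₀).levelHom 1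
      (arborealRep (unicriticalPoly a b c d) x₀ σ) = 1) : hζ.autToPow F σ = 1 := by
  have : NeZero (d : SeparableClosure F) := hζ.neZero'
  set w := (algebraMap F (SeparableClosure F) x₀ - algebraMap F _ b) / algebraMap F _ a with hw
  have hw₀ : w ≠ 0 := by
    rw [hw, ← map_sub, ← map_div₀, Ne, map_eq_zero]
    exact div_ne_zero (sub_ne_zero.2 hx₀) ha
  have hfix (z : SeparableClosure F) (hz : z ^ d = w) : σ z = z := by
    have hσz : σ (z + algebraMap F _ c) = z + algebraMap F _ c := congrArg Subtype.val
      (Equiv.congr_fun hσ ⟨_, (aeval_add_unicriticalPoly_eq_iff ha).2 hz⟩)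
    rwa [map_add, σ.commutes, add_left_inj] at hσz
  obtain ⟨z, hz⟩ := IsSepClosed.exists_pow_nat_eq w d
  have hz₀ : z ≠ 0 := by
    rintro rfl
    exact hw₀ (by rw [← hz, zero_pow (NeZero.ne d)])
  have hζz := hfix (ζ * z) (by rw [mul_pow, hζ.pow_eq_one, one_mul, hz])
  rw [map_mul, hfix z hz, mul_left_inj' hz₀] at hζz
  exact autToPow_eq_one hζ hζz

end ArborealUnicritical

theorem prod_le_FPP_unicriticalPoly {F : Type*} [Field F] {a b c : F} {d : ℕ} [NeZero (d : F)]
    (hirr : Irreducible (cyclotomic d F)) (ha : a ≠ 0) {x₀ : F} (hx₀ : x₀ ≠ b) :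
    ∏ p ∈ d.primeFactors, ((p : ℝ) - 2) / ((p : ℝ) - 1) ≤
      LevelTree.FPP (arborealGroup (unicriticalPoly a b c d) x₀) := by
  have : NeZero d := .of_neZero_natCast F
  have : NeZero (d : SeparableClosure F) := NeZero.nat_of_injective (algebraMap F _).injective
  obtain ⟨ζ, hζ⟩ := HasEnoughRootsOfUnity.exists_primitiveRoot (SeparableClosure F) d
  have := finite_preimageTree_unicriticalPoly (b := b) (c := c) (d := d) ha x₀
  have hsurj (n : ℕ) : Function.Surjective
      ((preimageTree (unicriticalPoly a b c d) x₀).parent n) :=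
    parent_preimageTree_surjective (aeval_unicriticalPoly_surjective ha) x₀ n
  rw [← proportion_isUnit_sub_one]
  refine LevelTree.le_FPP hsurj fun n =>
    LevelTree.proportion_le_fixedProportion (autToPow_surjective hζ hirr) (fun σ hσ => ?_)
      fun σ hσ => ?_
  · exact autToPow_eq_one_of_levelHom_one_eq_one ha hζ hx₀
      (LevelTree.ker_levelHom_antitone hsurj (Nat.le_add_left 1 n) hσ)
  · exact exists_levelHom_arborealRep_apply_eq
      (fun _ => exists_fixed_preimage_unicriticalPoly ha hζ hσ) x₀ (n + 1)

theorem corollary2_general {K : Type*} [Field K] [CharZero K] (f : K[X]) (hf : IsUnicritical f)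
    (hirr : Irreducible (cyclotomic f.natDegree K)) :
    (Tendsto (LevelTree.fixedProportion (arithmeticGaloisGroup f)) atTop
        (𝓝 (LevelTree.FPP (arithmeticGaloisGroup f))) ∧
      ∏ p ∈ f.natDegree.primeFactors, ((p : ℝ) - 2) / ((p : ℝ) - 1)
        ≤ LevelTree.FPP (arithmeticGaloisGroup f)) ∧
    ∀ α : K, (∀ c ∈ criticalPoints f, aeval c f ≠ algebraMap K (AlgebraicClosure K) α) →
      Tendsto (LevelTree.fixedProportion (arborealGroup f α)) atTop
        (𝓝 (LevelTree.FPP (arborealGroup f α))) ∧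
      ∏ p ∈ f.natDegree.primeFactors, ((p : ℝ) - 2) / ((p : ℝ) - 1)
        ≤ LevelTree.FPP (arborealGroup f α) := by
  obtain ⟨a, b, c, d, ha, hd, hc, rfl⟩ := hf.exists_eq_unicriticalPoly
  rw [natDegree_unicriticalPoly ha] at hirr ⊢
  have : NeZero (d : K) := ⟨Nat.cast_ne_zero.2 hd⟩
  have : NeZero (d : RatFunc K) := NeZero.nat_of_injective (algebraMap K _).injective
  refine ⟨?_, fun α hα => ⟨tendsto_fixedProportion_unicriticalPoly ha α,
    prod_le_FPP_unicriticalPoly hirr ha ?_⟩⟩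
  · have ha' : algebraMap K (RatFunc K) a ≠ 0 := by simpa using ha
    have hirr' := irreducible_map_ratFunc (cyclotomic.monic d K) hirr
    rw [map_cyclotomic] at hirr'
    rw [arithmeticGaloisGroup, map_unicriticalPoly]
    exact ⟨tendsto_fixedProportion_unicriticalPoly ha' _,
      prod_le_FPP_unicriticalPoly hirr' ha' (ratFunc_X_ne_algebraMap b)⟩
  · rintro rfl
    exact hα _ hc (aeval_algebraMap_unicriticalPoly hd)

theorem corollary2 (f : ℚ[X]) (d : ℕ) (hdeg : f.natDegree = d) (hodd : Odd d) (hd : 3 ≤ d)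
    (hf : IsUnicritical f) :
    0 < ∏ p ∈ d.primeFactors, ((p : ℝ) - 2) / ((p : ℝ) - 1) ∧
    (Tendsto (LevelTree.fixedProportion (arithmeticGaloisGroup f)) atTop
        (𝓝 (LevelTree.FPP (arithmeticGaloisGroup f))) ∧
      ∏ p ∈ d.primeFactors, ((p : ℝ) - 2) / ((p : ℝ) - 1)
        ≤ LevelTree.FPP (arithmeticGaloisGroup f)) ∧
    (∀ α : ℚ, ¬ IsStrictlyPostcritical f α →
      Tendsto (LevelTree.fixedProportion (arborealGroup f α)) atTop
        (𝓝 (LevelTree.FPP (arborealGroup f α))) ∧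
      ∏ p ∈ d.primeFactors, ((p : ℝ) - 2) / ((p : ℝ) - 1)
        ≤ LevelTree.FPP (arborealGroup f α)) := by
  subst hdeg
  obtain ⟨hgeneric, hspecial⟩ := corollary2_general f hf (cyclotomic.irreducible_rat (by omega))
  exact ⟨prod_sub_two_div_sub_one_pos hodd, hgeneric,
    fun α hα => hspecial α fun c hc h => hα ⟨1, le_rfl, c, hc, h⟩⟩
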